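/- Let $\mathcal M$ be a pointed combinatorial monoidal model category. That is, $\mathcal M$ is a model category such that: - (pointed) $\mathcal M$ has a zero object; - (combinatorial) the category $\mathcal M$ is locally presentable and its model structure is cofibrantly generated; - (monoidal) $\mathcal M$ has a closed, not necessarily symmetric, monoidal structure $(\otimes, S)$, so that $E\otimes -$ and $-\otimes E$ have right adjoints for every object $E$. It satisfies the pushout-product axiom: the pushout-product of two cofibrations is a cofibration, which is trivial if one of the two is trivial. It also satisfies the unit axiom: if $q\colon QS\to S$ is a cofibrant replacement of the unit, then $q\otimes X$ and $X\otimes q$ are weak equivalences for every cofibrant $X$. Let $\mathrm{Ho}(\mathcal M)$ be the homotopy category of $\mathcal M$, i.e. its localization at the weak equivalences, and let $\otimes^{L}\colon \mathrm{Ho}(\mathcal M)\times \mathrm{Ho}(\mathcal M)\to \mathrm{Ho}(\mathcal M)$ be the derived tensor product, i.e. the total left derived functor of $\otimes$. For an object $E$ of $\mathcal M$, its Bousfield class is $$\langle E\rangle=\{X\in\mathcal M \;:\; E\otimes^{L}X \text{ is isomorphic to the terminal object in } \mathrm{Ho}(\mathcal M)\}.$$ Then there is only a set (not a proper class) of distinct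 Bousfield classes $\langle E\rangle$, where $E$ runs over all objects of $\mathcal M$. -/

import Mathlib

universe w v u

namespace BousfieldOhkawa

open CategoryTheory Limits MonoidalCategory MonoidalCategory.Arrow HomotopicalAlgebra

/-! ### Combinatorial model categories -/

/-- A model category is cofibrantly generated (with respect to the universe `w`, whose types are
the sets) if there are a set `I` of generating cofibrations and a set `J` of generating trivial
cofibrations, both permitting the small object argument, such that the trivial fibrations are the
morphisms with the right lifting property with respect to `I` and the fibrations are the morphisms
with the right lifting property with respect to `J`. -/
class IsCofibrantlyGenerated (M : Type u) [Category.{v} M] [ModelCategory M] : Prop where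
  exists_generators : ∃ I J : MorphismProperty M,
    MorphismProperty.IsSmall.{w} I ∧ MorphismProperty.IsSmall.{w} J ∧
    MorphismProperty.HasSmallObjectArgument.{w} I ∧
    MorphismProperty.HasSmallObjectArgument.{w} J ∧
    I.rlp = trivialFibrations M ∧ J.rlp = fibrations M

/-- A combinatorial model category: the underlying category is locally presentable and the model
structure is cofibrantly generated. -/
class IsCombinatorial (M : Type u) [Category.{v} M] [ModelCategory M] : Prop where
  isLocallyPresentable : IsLocallyPresentable.{w} M
  isCofibrantlyGenerated : IsCofibrantlyGenerated.{w} M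

/-! ### Monoidal model categories -/

/-- A (not necessarily symmetric) monoidal model category: a closed monoidal category (both
`X ⊗ -` and `- ⊗ X` have right adjoints) with a model structure such that the pushout-product
axiom and the unit axiom hold. -/
class IsMonoidalModelCategory (M : Type u) [Category.{v} M] [ModelCategory M]
    [MonoidalCategory M] : Prop where
  isLeftAdjoint_tensorLeft (X : M) : (tensorLeft X).IsLeftAdjoint
  isLeftAdjoint_tensorRight (X : M) : (tensorRight X).IsLeftAdjoint
  /-- The pushout-product of two cofibrations is a cofibration. -/
  cofibration_pushoutProduct {A B X Y : M} (f : A ⟶ B) (g : X ⟶ Y)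
    [Cofibration f] [Cofibration g] :
    Cofibration ((pushoutProduct.obj (Arrow.mk f)).obj (Arrow.mk g)).hom
  /-- The pushout-product of a trivial cofibration and a cofibration is a weak equivalence. -/
  weakEquivalence_pushoutProduct_left {A B X Y : M} (f : A ⟶ B) (g : X ⟶ Y)
    [Cofibration f] [WeakEquivalence f] [Cofibration g] :
    WeakEquivalence ((pushoutProduct.obj (Arrow.mk f)).obj (Arrow.mk g)).hom
  /-- The pushout-product of a cofibration and a trivial cofibration is a weak equivalence. -/
  weakEquivalence_pushoutProduct_right {A B X Y : M} (f : A ⟶ B) (g : X ⟶ Y)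
    [Cofibration f] [Cofibration g] [WeakEquivalence g] :
    WeakEquivalence ((pushoutProduct.obj (Arrow.mk f)).obj (Arrow.mk g)).hom
  /-- The unit axiom on the left: if `q : Q ⟶ 𝟙_ M` is a cofibrant replacement of the unit, then
  `q ⊗ X` is a weak equivalence for all cofibrant `X`. -/
  weakEquivalence_whiskerRight_unit {Q : M} (q : Q ⟶ 𝟙_ M) [IsCofibrant Q] [Fibration q]
    [WeakEquivalence q] (X : M) [IsCofibrant X] : WeakEquivalence (q ▷ X)
  /-- The unit axiom on the right. -/
  weakEquivalence_whiskerLeft_unit {Q : M} (q : Q ⟶ 𝟙_ M) [IsCofibrant Q] [Fibration q]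
    [WeakEquivalence q] (X : M) [IsCofibrant X] : WeakEquivalence (X ◁ q)

/-! ### Existence of the derived tensor product -/

section General

variable {C D H : Type*} [Category* C] [Category* D] [Category* H]

/-- If the opposite functor has a right derived functor, then the functor has a left derived
functor. -/
lemma hasLeftDerivedFunctor_of_op (F : C ⥤ H) (W : MorphismProperty C)
    [F.op.HasRightDerivedFunctor W.op] : F.HasLeftDerivedFunctor W := by
  let L := W.Q
  let R := F.op.totalRightDerived L.op W.op
  let α : F.op ⟶ L.op ⋙ R := F.op.totalRightDerivedUnit L.op W.op
  let LF : W.Localization ⥤ H := R.unop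
  let β : L ⋙ LF ⟶ F :=
    { app := fun X ↦ (α.app (Opposite.op X)).unop
      naturality := fun X Y f ↦ Quiver.Hom.op_inj (α.naturality f.op).symm }
  let opTrans (G : W.Localization ⥤ H) (γ : L ⋙ G ⟶ F) : F.op ⟶ L.op ⋙ G.op :=
    { app := fun X ↦ (γ.app X.unop).op
      naturality := fun X Y f ↦ Quiver.Hom.unop_inj (γ.naturality f.unop).symm }
  let desc (G : W.Localization ⥤ H) (γ : L ⋙ G ⟶ F) : G ⟶ LF :=
    { app := fun X ↦ ((R.rightDerivedDesc α W.op G.op (opTrans G γ)).app (Opposite.op X)).unop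
      naturality := fun X Y f ↦ Quiver.Hom.op_inj
        ((R.rightDerivedDesc α W.op G.op (opTrans G γ)).naturality f.op).symm }
  have fac (G : W.Localization ⥤ H) (γ : L ⋙ G ⟶ F) :
      Functor.whiskerLeft L (desc G γ) ≫ β = γ := by
    ext X
    exact Quiver.Hom.op_inj
      (R.rightDerived_fac_app α W.op G.op (opTrans G γ) (Opposite.op X))
  have ext' (G : W.Localization ⥤ H) (γ γ' : G ⟶ LF)
      (h : Functor.whiskerLeft L γ ≫ β = Functor.whiskerLeft L γ' ≫ β) : γ = γ' := by
    let t (δ : G ⟶ LF) : R ⟶ G.op :=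
      { app := fun X ↦ (δ.app X.unop).op
        naturality := fun X Y f ↦ Quiver.Hom.unop_inj (δ.naturality f.unop).symm }
    have key : t γ = t γ' := R.rightDerived_ext α W.op G.op _ _ (by
      ext X
      exact Quiver.Hom.unop_inj (congr_app h X.unop))
    ext X
    exact congrArg Quiver.Hom.unop (congr_app key (Opposite.op X))
  have : LF.IsRightKanExtension β := ⟨⟨IsTerminal.ofUniqueHom
    (fun G ↦ CostructuredArrow.homMk (desc G.left G.hom) (fac G.left G.hom))
    (fun G m ↦ CostructuredArrow.hom_ext _ _
      (ext' G.left _ _ ((CostructuredArrow.w m).trans (fac G.left G.hom).symm)))⟩⟩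
  exact ⟨Functor.HasRightKanExtension.mk LF β⟩

end General

section Tensor

variable {M : Type u} [Category.{v} M] [ModelCategory M]

/-- The inclusion of pairs of cofibrant objects into pairs of objects. -/
def cofibrantPairs : LocalizerMorphism
    ((weakEquivalences (CofibrantObject M)).prod (weakEquivalences (CofibrantObject M)))
    ((weakEquivalences M).prod (weakEquivalences M)) where
  functor := CofibrantObject.ι.prod CofibrantObject.ι
  map _ _ f hf := ⟨(CofibrantObject.localizerMorphism M).map f.1 hf.1,
    (CofibrantObject.localizerMorphism M).map f.2 hf.2⟩

instance : (cofibrantPairs (M := M)).IsLocalizedEquivalence := by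
  let L := (weakEquivalences M).Q
  have : (cofibrantPairs.functor ⋙ L.prod L).IsLocalization
      ((weakEquivalences (CofibrantObject M)).prod (weakEquivalences (CofibrantObject M))) :=
    inferInstanceAs (((CofibrantObject.ι (C := M) ⋙ L).prod
      (CofibrantObject.ι (C := M) ⋙ L)).IsLocalization
      ((weakEquivalences (CofibrantObject M)).prod (weakEquivalences (CofibrantObject M))))
  exact LocalizerMorphism.IsLocalizedEquivalence.of_isLocalization_of_isLocalization _ (L.prod L)

instance (X : M × M) : IsConnected ((cofibrantPairs (M := M)).LeftResolution X) := by
  let R₀ : (cofibrantPairs (M := M)).LeftResolution X :=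
    { X₁ := (CofibrantObject.mk (CofibrantObject.HoCat.resolutionObj X.1),
        CofibrantObject.mk (CofibrantObject.HoCat.resolutionObj X.2))
      w := (CofibrantObject.HoCat.pResolutionObj X.1, CofibrantObject.HoCat.pResolutionObj X.2)
      hw := ⟨mem_weakEquivalences (CofibrantObject.HoCat.pResolutionObj X.1),
        mem_weakEquivalences (CofibrantObject.HoCat.pResolutionObj X.2)⟩ }
  have hR₀ (R : (cofibrantPairs (M := M)).LeftResolution X) : Nonempty (Zigzag R R₀) := by
    let w₁ : R.X₁.1.obj ⟶ X.1 := R.w.1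
    let w₂ : R.X₁.2.obj ⟶ X.2 := R.w.2
    have sq₁ : CommSq (initial.to _) (initial.to R.X₁.1.obj)
      (CofibrantObject.HoCat.pResolutionObj X.1) w₁ := ⟨by simp⟩
    have sq₂ : CommSq (initial.to _) (initial.to R.X₁.2.obj)
      (CofibrantObject.HoCat.pResolutionObj X.2) w₂ := ⟨by simp⟩
    exact ⟨Zigzag.of_hom
      { f := (CofibrantObject.homMk sq₁.lift, CofibrantObject.homMk sq₂.lift)
        comm := Prod.ext sq₁.fac_right sq₂.fac_right }⟩
  have : Nonempty ((cofibrantPairs (M := M)).LeftResolution X) := ⟨R₀⟩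
  exact zigzag_isConnected (fun R₁ R₂ ↦ (hR₀ R₁).some.trans (hR₀ R₂).some.symm)

instance : (cofibrantPairs (M := M)).arrow.HasLeftResolutions :=
  fun f ↦ ⟨{
    X₁ := Arrow.mk (X := (CofibrantObject.mk (CofibrantObject.HoCat.resolutionObj f.left.1),
          CofibrantObject.mk (CofibrantObject.HoCat.resolutionObj f.left.2)))
        (Y := (CofibrantObject.mk (CofibrantObject.HoCat.resolutionObj f.right.1),
          CofibrantObject.mk (CofibrantObject.HoCat.resolutionObj f.right.2)))
        (CofibrantObject.homMk (CofibrantObject.HoCat.resolutionMap f.hom.1),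
          CofibrantObject.homMk (CofibrantObject.HoCat.resolutionMap f.hom.2))
    w := Arrow.homMk
      (CofibrantObject.HoCat.pResolutionObj f.left.1,
        CofibrantObject.HoCat.pResolutionObj f.left.2)
      (CofibrantObject.HoCat.pResolutionObj f.right.1,
        CofibrantObject.HoCat.pResolutionObj f.right.2)
      (Prod.ext (CofibrantObject.HoCat.resolutionMap_fac f.hom.1).symm
        (CofibrantObject.HoCat.resolutionMap_fac f.hom.2).symm)
    hw := ⟨⟨mem_weakEquivalences (CofibrantObject.HoCat.pResolutionObj f.left.1),
        mem_weakEquivalences (CofibrantObject.HoCat.pResolutionObj f.left.2)⟩,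
      ⟨mem_weakEquivalences (CofibrantObject.HoCat.pResolutionObj f.right.1),
        mem_weakEquivalences (CofibrantObject.HoCat.pResolutionObj f.right.2)⟩⟩ }⟩

instance : (cofibrantPairs (M := M)).IsLeftDerivabilityStructure := .mk' _

variable [MonoidalCategory M] [IsMonoidalModelCategory M]

lemma weakEquivalence_whiskerRight_of_cofibration {A B : M} (f : A ⟶ B) (X : M)
    [Cofibration f] [WeakEquivalence f] [IsCofibrant X] : WeakEquivalence (f ▷ X) := by
  have hX (A : M) : IsInitial (A ⊗ (⊥_ M)) :=
    have := IsMonoidalModelCategory.isLeftAdjoint_tensorLeft A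
    initialIsInitial.isInitialObj (tensorLeft A) _
  have : IsIso (f ▷ (⊥_ M)) := isIso_of_isInitial (hX A) (hX B) _
  let p : pushout (f ▷ (⊥_ M)) (A ◁ initial.to X) ⟶ B ⊗ X :=
    ((pushoutProduct.obj (Arrow.mk f)).obj (Arrow.mk (initial.to X))).hom
  have : WeakEquivalence p :=
    IsMonoidalModelCategory.weakEquivalence_pushoutProduct_left f (initial.to X)
  have fac : pushout.inr (f ▷ (⊥_ M)) (A ◁ initial.to X) ≫ p = f ▷ X := pushout.inr_desc _ _ _
  rw [← fac]
  infer_instance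

lemma weakEquivalence_whiskerLeft_of_cofibration {A B : M} (f : A ⟶ B) (X : M)
    [Cofibration f] [WeakEquivalence f] [IsCofibrant X] : WeakEquivalence (X ◁ f) := by
  have hX (A : M) : IsInitial ((⊥_ M) ⊗ A) :=
    have := IsMonoidalModelCategory.isLeftAdjoint_tensorRight A
    initialIsInitial.isInitialObj (tensorRight A) _
  have : IsIso ((⊥_ M) ◁ f) := isIso_of_isInitial (hX A) (hX B) _
  let p : pushout (initial.to X ▷ A) ((⊥_ M) ◁ f) ⟶ X ⊗ B :=
    ((pushoutProduct.obj (Arrow.mk (initial.to X))).obj (Arrow.mk f)).hom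
  have : WeakEquivalence p :=
    IsMonoidalModelCategory.weakEquivalence_pushoutProduct_right (initial.to X) f
  have fac : pushout.inl (initial.to X ▷ A) ((⊥_ M) ◁ f) ≫ p = X ◁ f := pushout.inl_desc _ _ _
  rw [← fac]
  infer_instance

lemma weakEquivalence_whiskerRight {A B : M} (f : A ⟶ B) (X : M) [IsCofibrant A] [IsCofibrant B]
    [WeakEquivalence f] [IsCofibrant X] : WeakEquivalence (f ▷ X) := by
  let h : CofibrantBrownFactorization f := Classical.arbitrary _
  have : Cofibration h.i := (cofibration_iff _).2 h.hi
  have h₁ := weakEquivalence_whiskerRight_of_cofibration h.i X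
  have h₂ := weakEquivalence_whiskerRight_of_cofibration h.s X
  have fac : h.s ▷ X ≫ h.p ▷ X = 𝟙 _ := by
    rw [← comp_whiskerRight, h.s_p, id_whiskerRight]
  have h₃ : WeakEquivalence (h.p ▷ X) := weakEquivalence_of_precomp_of_fac fac
  rw [← h.fac, comp_whiskerRight]
  infer_instance

lemma weakEquivalence_whiskerLeft {A B : M} (f : A ⟶ B) (X : M) [IsCofibrant A] [IsCofibrant B]
    [WeakEquivalence f] [IsCofibrant X] : WeakEquivalence (X ◁ f) := by
  let h : CofibrantBrownFactorization f := Classical.arbitrary _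
  have : Cofibration h.i := (cofibration_iff _).2 h.hi
  have h₁ := weakEquivalence_whiskerLeft_of_cofibration h.i X
  have h₂ := weakEquivalence_whiskerLeft_of_cofibration h.s X
  have fac : X ◁ h.s ≫ X ◁ h.p = 𝟙 _ := by
    rw [← MonoidalCategory.whiskerLeft_comp, h.s_p, MonoidalCategory.whiskerLeft_id]
  have h₃ : WeakEquivalence (X ◁ h.p) := weakEquivalence_of_precomp_of_fac fac
  rw [← h.fac, MonoidalCategory.whiskerLeft_comp]
  infer_instance

lemma derives_tensor :
    (cofibrantPairs (M := M)).Derives (tensor M ⋙ (weakEquivalences M).Q) := by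
  intro X Y f hf
  have : WeakEquivalence f.1.hom := (weakEquivalence_iff _).2 hf.1
  have : WeakEquivalence f.2.hom := (weakEquivalence_iff _).2 hf.2
  have h₁ := weakEquivalence_whiskerRight f.1.hom X.2.obj
  have h₂ := weakEquivalence_whiskerLeft f.2.hom Y.1.obj
  apply Localization.inverts (weakEquivalences M).Q (weakEquivalences M)
  rw [← weakEquivalence_iff]
  change WeakEquivalence (f.1.hom ⊗ₘ f.2.hom)
  rw [MonoidalCategory.tensorHom_def]
  infer_instance

instance : (tensor M ⋙ (weakEquivalences M).Q).HasLeftDerivedFunctor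
    ((weakEquivalences M).prod (weakEquivalences M)) := by
  have h : (cofibrantPairs (M := M)).op.Derives (tensor M ⋙ (weakEquivalences M).Q).op :=
    fun _ _ f hf ↦ by
      have := derives_tensor f.unop hf
      exact inferInstanceAs (IsIso
        (((cofibrantPairs (M := M)).functor ⋙ tensor M ⋙ (weakEquivalences M).Q).map f.unop).op)
  have := h.hasPointwiseRightDerivedFunctor
  exact hasLeftDerivedFunctor_of_op _ _

end Tensor

variable (M : Type u) [Category.{v} M] [ModelCategory M]

/-- The homotopy category `Ho(M)`: the localization at the weak equivalences. -/
abbrev Ho := (weakEquivalences M).Localization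

/-- The localization functor `M ⥤ Ho(M)`. -/
abbrev toHo : M ⥤ Ho M := (weakEquivalences M).Q

/-- The derived tensor product: the total left derived functor of
`M × M ⥤ Ho(M)`, `(E, X) ↦ E ⊗ X`. -/
noncomputable def derivedTensor [MonoidalCategory M] [IsMonoidalModelCategory M] :
    Ho M × Ho M ⥤ Ho M :=
  (tensor M ⋙ toHo M).totalLeftDerived ((toHo M).prod (toHo M))
    ((weakEquivalences M).prod (weakEquivalences M))

variable {M}

/-- The Bousfield class of `E`: the class of all objects `X` such that the derived tensor product
of `E` and `X` is (isomorphic to) the terminal object of `Ho(M)`. -/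
def bousfieldClass [MonoidalCategory M] [IsMonoidalModelCategory M] (E : M) : Set M :=
  {X | Nonempty (IsTerminal ((derivedTensor M).obj ((toHo M).obj E, (toHo M).obj X)))}

end BousfieldOhkawa

/-! This is Ohkawa's argument, run on functors instead of homology theories. Let Q be cofibrant
replacement and R the fibrant replacement obtained from the small object argument for the generating
trivial cofibrations J. Since the category is pointed, X lies in ⟨E⟩ exactly when R(QE ⊗ QX) → * is
a trivial fibration, that is, when every map A → H_E(QX) extends along every generating cofibration
A → B, where H_E = R(QE ⊗ -).

One regular cardinal κ makes every H_E κ-accessible: QE ⊗ - is a left adjoint, and R is κ-accessible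
once the sources and targets of J are κ-presentable (`isCardinalAccessible_smallObjectReplacement`).
Every object is a κ-filtered colimit of objects from a fixed small P. For Y in P and x : A → H_E(Y),
record the set of maps g out of Y inside P after which x extends; this plays the role of an
annihilator ideal. The collection of these sets, over all x, determines the class
(`HasExtensions.of_extensionSets_eq`), and it ranges over iterated power sets of small sets. -/

namespace BousfieldOhkawa

open CategoryTheory Limits Opposite SmallObject

/-! ### Accessibility of the small object argument -/

section FunctorObj

variable {C : Type u} [Category.{v} C] {I : Type*} {A B : I → C} (f : ∀ i, A i ⟶ B i)

section Presentable

variable {J : Type w} [SmallCategory J] (κ : Cardinal.{w}) [Fact κ.IsRegular]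
  [IsCardinalFiltered J κ] [∀ i, IsCardinalPresentable (A i) κ]
  [∀ i, IsCardinalPresentable (B i) κ]
  {K : J ⥤ Arrow C} {c : Cocone K} (hl : IsColimit (Arrow.leftFunc.mapCocone c))
  (hr : IsColimit (Arrow.rightFunc.mapCocone c))

include κ hl hr

/-- Lift `t` and `b` separately; the two composites out of `A i` agree in the colimit, hence at a
later stage. With `exists_functorObjIndex_eq`, this makes `f i` behave as a κ-presentable object of
the arrow category. -/
lemma exists_functorObjIndex_lift {i : I} (t : A i ⟶ c.pt.left) (b : B i ⟶ c.pt.right)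
    (sq : t ≫ c.pt.hom = f i ≫ b) :
    ∃ (j : J) (t' : A i ⟶ (K.obj j).left) (b' : B i ⟶ (K.obj j).right),
      t' ≫ (K.obj j).hom = f i ≫ b' ∧ t' ≫ (c.ι.app j).left = t ∧
        b' ≫ (c.ι.app j).right = b := by
  have := isFiltered_of_isCardinalFiltered J κ
  obtain ⟨j₁, (t₁ : A i ⟶ (K.obj j₁).left), (ht₁ : t₁ ≫ (c.ι.app j₁).left = t)⟩ :=
    IsCardinalPresentable.exists_hom_of_isColimit κ hl t
  obtain ⟨j₂, (b₂ : B i ⟶ (K.obj j₂).right), (hb₂ : b₂ ≫ (c.ι.app j₂).right = b)⟩ :=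
    IsCardinalPresentable.exists_hom_of_isColimit κ hr b
  obtain ⟨k, u, v, huv⟩ := IsCardinalPresentable.exists_eq_of_isColimit κ hr
    (i₁ := j₁) (i₂ := j₂) (t₁ ≫ (K.obj j₁).hom) (f i ≫ b₂) (by
      change (t₁ ≫ (K.obj j₁).hom) ≫ (c.ι.app j₁).right = (f i ≫ b₂) ≫ (c.ι.app j₂).right
      rw [Category.assoc, Category.assoc, hb₂, ← sq, ← ht₁, Category.assoc]
      congr 1
      exact (Arrow.w (c.ι.app j₁)).symm)
  replace huv : (t₁ ≫ (K.obj j₁).hom) ≫ (K.map u).right = (f i ≫ b₂) ≫ (K.map v).right := huv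
  refine ⟨k, t₁ ≫ (K.map u).left, b₂ ≫ (K.map v).right, ?_, ?_, ?_⟩
  · rw [Category.assoc, ← Category.assoc (f i), ← huv, Category.assoc]
    congr 1
    exact Arrow.w (K.map u)
  · rw [Category.assoc, ← ht₁, ← c.w u]
    rfl
  · rw [Category.assoc, ← hb₂, ← c.w v]
    rfl

lemma exists_functorObjIndex_eq {i : I} {j₁ j₂ : J} (t₁ : A i ⟶ (K.obj j₁).left)
    (b₁ : B i ⟶ (K.obj j₁).right) (t₂ : A i ⟶ (K.obj j₂).left) (b₂ : B i ⟶ (K.obj j₂).right)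
    (ht : t₁ ≫ (c.ι.app j₁).left = t₂ ≫ (c.ι.app j₂).left)
    (hb : b₁ ≫ (c.ι.app j₁).right = b₂ ≫ (c.ι.app j₂).right) :
    ∃ (k : J) (u : j₁ ⟶ k) (v : j₂ ⟶ k),
      t₁ ≫ (K.map u).left = t₂ ≫ (K.map v).left ∧
        b₁ ≫ (K.map u).right = b₂ ≫ (K.map v).right := by
  have := isFiltered_of_isCardinalFiltered J κ
  obtain ⟨k₁, u₁, v₁, h₁⟩ := IsCardinalPresentable.exists_eq_of_isColimit κ hl t₁ t₂ ht
  replace h₁ : t₁ ≫ (K.map u₁).left = t₂ ≫ (K.map v₁).left := h₁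
  obtain ⟨k, w, h₂⟩ := IsCardinalPresentable.exists_eq_of_isColimit' κ hr
    (i := k₁) (b₁ ≫ (K.map u₁).right) (b₂ ≫ (K.map v₁).right) (by
      change (b₁ ≫ (K.map u₁).right) ≫ (c.ι.app k₁).right =
        (b₂ ≫ (K.map v₁).right) ≫ (c.ι.app k₁).right
      rw [Category.assoc, Category.assoc, ← Arrow.comp_right, ← Arrow.comp_right, c.w, c.w, hb])
  replace h₂ : (b₁ ≫ (K.map u₁).right) ≫ (K.map w).right =
    (b₂ ≫ (K.map v₁).right) ≫ (K.map w).right := h₂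
  refine ⟨k, u₁ ≫ w, v₁ ≫ w, ?_, ?_⟩
  · rw [K.map_comp, K.map_comp, Arrow.comp_left, Arrow.comp_left, ← Category.assoc, h₁,
      Category.assoc]
  · rw [K.map_comp, K.map_comp, Arrow.comp_right, Arrow.comp_right, ← Category.assoc, h₂,
      Category.assoc]

end Presentable

variable [HasPushouts C]
  [∀ {X S : C} (πX : X ⟶ S), HasColimitsOfShape (Discrete (FunctorObjIndex f πX)) C]

/-- The cell of `functorObj f π` attached along a commutative square. -/
noncomputable def cell {X S : C} {π : X ⟶ S} (x : FunctorObjIndex f π) :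
    B x.i ⟶ functorObj f π :=
  Sigma.ι (functorObjTgtFamily f π) x ≫ ρFunctorObj f π

lemma cell_comm {X S : C} {π : X ⟶ S} (x : FunctorObjIndex f π) :
    f x.i ≫ cell f x = x.t ≫ ιFunctorObj f π :=
  x.comm

lemma functorObj_hom_ext {X S : C} {π : X ⟶ S} {Z : C} {g h : functorObj f π ⟶ Z}
    (h₀ : ιFunctorObj f π ≫ g = ιFunctorObj f π ≫ h)
    (h₁ : ∀ x : FunctorObjIndex f π, cell f x ≫ g = cell f x ≫ h) : g = h := by
  apply pushout.hom_ext
  · exact h₀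
  · apply Sigma.hom_ext
    intro x
    simpa only [cell, Category.assoc] using h₁ x

lemma exists_functorObj_desc {X S : C} {π : X ⟶ S} {Z : C} (a : X ⟶ Z)
    (b : ∀ x : FunctorObjIndex f π, B x.i ⟶ Z) (h : ∀ x, f x.i ≫ b x = x.t ≫ a) :
    ∃ d : functorObj f π ⟶ Z, ιFunctorObj f π ≫ d = a ∧ ∀ x, cell f x ≫ d = b x := by
  refine ⟨pushout.desc a (Sigma.desc b) ?_, pushout.inl_desc _ _ _, fun x ↦ ?_⟩
  · apply Sigma.hom_ext
    intro x
    rw [Sigma.ι_desc_assoc, Sigma.ι_map_assoc, Sigma.ι_desc]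
    exact (h x).symm
  · rw [cell, Category.assoc]
    refine (congrArg (Sigma.ι (functorObjTgtFamily f π) x ≫ ·) (pushout.inr_desc _ _ _)).trans ?_
    exact Sigma.ι_desc _ _

/-- The image square is a variable `y` pinned down by equations, so that it can be either a
composite or a square given in advance. -/
lemma cell_map {X S Y T : C} {πX : X ⟶ S} {πY : Y ⟶ T} (τ : Arrow.mk πX ⟶ Arrow.mk πY)
    (x : FunctorObjIndex f πX) (y : FunctorObjIndex f πY) (hi : x.i = y.i)
    (ht : x.t ≫ τ.left = eqToHom (by rw [hi]) ≫ y.t)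
    (hb : x.b ≫ τ.right = eqToHom (by rw [hi]) ≫ y.b) :
    cell f x ≫ functorMap f τ = eqToHom (by rw [hi]) ≫ cell f y := by
  obtain ⟨i, t, b, w⟩ := x
  obtain ⟨i', t', b', w'⟩ := y
  obtain rfl : i = i' := hi
  simp only [eqToHom_refl, Category.id_comp] at ht hb
  rw [eqToHom_refl, Category.id_comp, cell, cell, Category.assoc]
  have : ρFunctorObj f πX ≫ functorMap f τ = functorMapTgt f τ ≫ ρFunctorObj f πY :=
    pushout.inr_desc _ _ _
  rw [this]
  exact ι_functorMapTgt_assoc f τ i t b w b' hb t' ht _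

variable {J : Type w} [SmallCategory J] (κ : Cardinal.{w}) [Fact κ.IsRegular]
  [IsCardinalFiltered J κ] [∀ i, IsCardinalPresentable (A i) κ]
  [∀ i, IsCardinalPresentable (B i) κ]
  {K : J ⥤ Arrow C} {c : Cocone K} (hl : IsColimit (Arrow.leftFunc.mapCocone c))
  (hr : IsColimit (Arrow.rightFunc.mapCocone c))

include κ hl hr

/-- A map out of `functorObj` is a map on the source together with compatible values on the cells,
and every cell over the colimit is the image of a cell at some stage. -/
lemma existsUnique_functorObj_desc {Z : C}
    (s : ∀ j, functorObj f (K.obj j).hom ⟶ Z)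
    (hs : ∀ {j k : J} (u : j ⟶ k), functorMap f (K.map u) ≫ s k = s j) :
    ∃! d : functorObj f c.pt.hom ⟶ Z, ∀ j, functorMap f (c.ι.app j) ≫ d = s j := by
  obtain ⟨a, ha⟩ : ∃ a : c.pt.left ⟶ Z,
      ∀ j, (c.ι.app j).left ≫ a = ιFunctorObj f (K.obj j).hom ≫ s j := by
    let s' : Cocone (K ⋙ Arrow.leftFunc) :=
      { pt := Z
        ι := { app j := ιFunctorObj f (K.obj j).hom ≫ s j
               naturality j k u := by
                 have h := ιFunctorObj_naturality_assoc f (K.map u) (s k)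
                 rw [hs] at h
                 exact h.symm.trans (Category.comp_id _).symm } }
    exact ⟨hl.desc s', fun j ↦ hl.fac s' j⟩
  -- Well-definedness: squares with the same image in the colimit already agree at a later stage, so
  -- `s` takes the same value on their cells.
  have indep {i : I} {j₁ j₂ : J} (x₁ : FunctorObjIndex f (K.obj j₁).hom)
      (x₂ : FunctorObjIndex f (K.obj j₂).hom) (h₁ : x₁.i = i) (h₂ : x₂.i = i)
      (ht : eqToHom (by rw [h₁]) ≫ x₁.t ≫ (c.ι.app j₁).left =
        eqToHom (by rw [h₂]) ≫ x₂.t ≫ (c.ι.app j₂).left)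
      (hb : eqToHom (by rw [h₁]) ≫ x₁.b ≫ (c.ι.app j₁).right =
        eqToHom (by rw [h₂]) ≫ x₂.b ≫ (c.ι.app j₂).right) :
      eqToHom (by rw [h₁]) ≫ cell f x₁ ≫ s j₁ =
        (eqToHom (by rw [h₂]) : B i ⟶ _) ≫ cell f x₂ ≫ s j₂ := by
    obtain ⟨i₁, t₁, b₁, w₁⟩ := x₁
    obtain ⟨i₂, t₂, b₂, w₂⟩ := x₂
    obtain rfl : i₁ = i := h₁
    obtain rfl : i₂ = i₁ := h₂
    simp only [eqToHom_refl, Category.id_comp] at ht hb ⊢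
    obtain ⟨k, u, v, hut, hub⟩ := exists_functorObjIndex_eq κ hl hr t₁ b₁ t₂ b₂ ht hb
    have w : (t₁ ≫ (K.map u).left) ≫ (K.obj k).hom = f i₂ ≫ b₁ ≫ (K.map u).right := by
      rw [Category.assoc, Arrow.w (K.map u), ← Category.assoc, w₁, Category.assoc]
    have e₁ := cell_map f (K.map u) ⟨i₂, t₁, b₁, w₁⟩ ⟨i₂, _, _, w⟩ rfl (by simp) (by simp)
    have e₂ := cell_map f (K.map v) ⟨i₂, t₂, b₂, w₂⟩ ⟨i₂, _, _, w⟩ rfl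
      (by simpa using hut.symm) (by simpa using hub.symm)
    rw [← hs u, ← hs v, ← Category.assoc, ← Category.assoc]
    exact congrArg (· ≫ s k) (e₁.trans e₂.symm)
  choose j t b w ht hb using fun x : FunctorObjIndex f c.pt.hom ↦
    exists_functorObjIndex_lift f κ hl hr x.t x.b x.w
  obtain ⟨d, hd, hd'⟩ := exists_functorObj_desc f a
    (fun x ↦ cell f (⟨x.i, t x, b x, w x⟩ : FunctorObjIndex f (K.obj (j x)).hom) ≫ s (j x))
    (fun x ↦ by
      rw [← Category.assoc]
      refine (congrArg (· ≫ s (j x)) (cell_comm f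
        (⟨x.i, t x, b x, w x⟩ : FunctorObjIndex f (K.obj (j x)).hom))).trans ?_
      rw [Category.assoc, ← ha, ← Category.assoc]
      exact congrArg (· ≫ a) (ht x))
  have hd'' (k : J) : functorMap f (c.ι.app k) ≫ d = s k := by
    refine functorObj_hom_ext f ?_ (fun x ↦ ?_)
    · have := ιFunctorObj_naturality_assoc f (c.ι.app k) d
      rw [this, ← ha, ← hd]
    · have w' : (x.t ≫ (c.ι.app k).left) ≫ c.pt.hom = f x.i ≫ x.b ≫ (c.ι.app k).right := by
        rw [Category.assoc]
        refine (congrArg (x.t ≫ ·) (Arrow.w (c.ι.app k))).trans ?_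
        rw [← Category.assoc]
        refine (congrArg (· ≫ (c.ι.app k).right) x.w).trans ?_
        exact Category.assoc _ _ _
      have e := cell_map f (c.ι.app k) x ⟨x.i, _, _, w'⟩ rfl (by simp) (by simp)
      rw [eqToHom_refl, Category.id_comp] at e
      rw [← Category.assoc]
      refine (congrArg (· ≫ d) e).trans ((hd' _).trans ?_)
      -- The stage chosen for the image of `x` need not be `k`.
      have := indep (i := x.i) ⟨x.i, t ⟨x.i, _, _, w'⟩, b ⟨x.i, _, _, w'⟩, w ⟨x.i, _, _, w'⟩⟩ x
        rfl rfl (by simpa using ht ⟨x.i, _, _, w'⟩) (by simpa using hb ⟨x.i, _, _, w'⟩)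
      simpa using this
  refine ⟨d, hd'', fun d₂ hd₂ ↦ functorObj_hom_ext f ?_ (fun x ↦ ?_)⟩
  · refine hl.hom_ext (fun k ↦ ?_)
    change (c.ι.app k).left ≫ _ = (c.ι.app k).left ≫ _
    have h₁ := ιFunctorObj_naturality_assoc f (c.ι.app k) d
    have h₂ := ιFunctorObj_naturality_assoc f (c.ι.app k) d₂
    rw [hd''] at h₁
    rw [hd₂] at h₂
    exact h₂.symm.trans h₁
  · have e := cell_map f (c.ι.app (j x)) ⟨x.i, t x, b x, w x⟩ x rfl
      (by simpa using ht x) (by simpa using hb x)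
    rw [eqToHom_refl, Category.id_comp] at e
    rw [← e, Category.assoc, Category.assoc]
    exact congrArg (_ ≫ ·) ((hd₂ _).trans (hd'' _).symm)

end FunctorObj

end BousfieldOhkawa



/-! ### Accessibility of the transfinite iteration and of fibrant replacement -/

namespace BousfieldOhkawa

open CategoryTheory Limits Opposite SmallObject

section

variable {C : Type u} [Category.{v} C] [HasColimitsOfSize.{w, w} C]
  (κ : Cardinal.{w}) [Fact κ.IsRegular]

section

variable {I : Type*} {A B : I → C} (f : ∀ i, A i ⟶ B i)
  [HasPushouts C]
  [∀ {X S : C} (πX : X ⟶ S), HasColimitsOfShape (Discrete (FunctorObjIndex f πX)) C]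

/-- The functor used in the small object argument for a family of morphisms between
`κ`-presentable objects is `κ`-accessible. -/
lemma isCardinalAccessible_smallObject_functor [∀ i, IsCardinalPresentable (A i) κ]
    [∀ i, IsCardinalPresentable (B i) κ] :
    (SmallObject.functor f).IsCardinalAccessible κ where
  preservesColimitOfShape J _ _ := ⟨fun {K} ↦ ⟨fun {c} hc ↦ by
    have hl : IsColimit (Arrow.leftFunc.mapCocone c) := isColimitOfPreserves _ hc
    have hr : IsColimit (Arrow.rightFunc.mapCocone c) := isColimitOfPreserves _ hc
    -- The functor leaves targets unchanged, so `hr` settles the target component.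
    refine ⟨Comma.fstSndJointlyReflectColimit ?_ hr⟩
    refine IsColimit.ofExistsUnique (fun s ↦ ?_)
    exact existsUnique_functorObj_desc f κ hl hr (fun j ↦ s.ι.app j) (fun u ↦ s.w u)⟩⟩

end

/-- `κ`-accessible functors are stable under colimits. -/
lemma isCardinalAccessible_of_isColimit {D : Type*} [Category* D] {E : Type*} [Category* E]
    [HasColimitsOfSize.{w, w} E] {K : Type*} [Category* K] [HasColimitsOfShape K E]
    {F : K ⥤ D ⥤ E} {c : Cocone F} (hc : IsColimit c)
    [∀ k, (F.obj k).IsCardinalAccessible κ] : c.pt.IsCardinalAccessible κ where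
  preservesColimitOfShape J _ _ := by
    have (k : K) : PreservesColimitsOfShape J (F.obj k) :=
      Functor.preservesColimitsOfShape_of_isCardinalAccessible _ κ J
    have : PreservesColimitsOfShape J F.flip :=
      preservesColimitsOfShape_of_evaluation _ _ (fun k ↦
        preservesColimitsOfShape_of_natIso (NatIso.ofComponents (fun _ ↦ Iso.refl _) :
          F.obj k ≅ F.flip ⋙ (evaluation K E).obj k))
    -- Colimits of functors are pointwise, and `colim` is a left adjoint, so it preserves what
    -- `F.flip` preserves.
    let e : F.flip ⋙ colim ≅ c.pt :=
      NatIso.ofComponents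
        (fun j ↦ (colimit.isColimit (F.flip.obj j)).coconePointUniqueUpToIso
          (isColimitOfPreserves ((evaluation _ _).obj j) hc))
        (fun {X Y} g ↦ colimit.hom_ext (fun k ↦ by simp))
    exact preservesColimitsOfShape_of_natIso e

/-- The transfinite iterations of a successor structure on a category of functors
which preserves `κ`-accessible functors are `κ`-accessible. -/
lemma isCardinalAccessible_iterationFunctor_obj {D : Type u} [Category.{v} D]
    [HasColimitsOfSize.{w, w} D] (Φ : SuccStruct (D ⥤ D))
    {J : Type w} [LinearOrder J] [OrderBot J] [SuccOrder J] [WellFoundedLT J]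
    [HasIterationOfShape J (D ⥤ D)]
    (h₀ : Φ.X₀.IsCardinalAccessible κ)
    (hs : ∀ F : D ⥤ D, F.IsCardinalAccessible κ → (Φ.succ F).IsCardinalAccessible κ) (j : J) :
    ((Φ.iterationFunctor J).obj j).IsCardinalAccessible κ := by
  induction j using SuccOrder.limitRecOn with
  | isMin j hj =>
    obtain rfl := hj.eq_bot
    exact Functor.isCardinalAccessible_of_natIso (Φ.iterationFunctorObjBotIso J).symm κ
  | succ j hj h =>
    have := hs _ h
    exact Functor.isCardinalAccessible_of_natIso (Φ.iterationFunctorObjSuccIso j hj).symm κ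
  | isSuccLimit j hj h =>
    have (k : Set.Iio j) : (((Set.principalSegIio j).monotone.functor ⋙
        Φ.iterationFunctor J).obj k).IsCardinalAccessible κ := h k.1 k.2
    exact isCardinalAccessible_of_isColimit κ
      ((Φ.iterationFunctor J).isColimitOfIsWellOrderContinuous j hj)

variable (I : MorphismProperty C) (κ₀ : Cardinal.{w}) [Fact κ₀.IsRegular]
  [OrderBot κ₀.ord.ToType] [I.IsCardinalForSmallObjectArgument κ₀]

/-- The functorial factorization given by the small object argument is `κ`-accessible for
any regular cardinal `κ` such that the generating morphisms are between
`κ`-presentable objects. -/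
lemma isCardinalAccessible_smallObject_iteration
    (hI : ∀ {A B : C} (i : A ⟶ B), I i → IsCardinalPresentable A κ ∧ IsCardinalPresentable B κ) :
    (SmallObject.iteration I κ₀).IsCardinalAccessible κ := by
  have := hasColimitsOfShape_discrete I κ₀
  have := hasPushouts I κ₀
  have := hasIterationOfShape I κ₀
  have : HasColimitsOfSize.{w, w} (Arrow C) := ⟨fun _ _ ↦ inferInstance⟩
  have (i : I.toSet) : IsCardinalPresentable i.1.left κ := (hI _ i.2).1
  have (i : I.toSet) : IsCardinalPresentable i.1.right κ := (hI _ i.2).2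
  have := isCardinalAccessible_smallObject_functor κ I.homFamily
  -- `κ₀` is the length of the iteration and `κ` the accessibility rank. They need not be related,
  -- since colimits commute with colimits.
  have (j : κ₀.ord.ToType) := isCardinalAccessible_iterationFunctor_obj κ (succStruct I κ₀)
    (inferInstanceAs ((𝟭 (Arrow C)).IsCardinalAccessible κ))
    (fun F hF ↦ inferInstanceAs ((F ⋙ SmallObject.functor I.homFamily).IsCardinalAccessible κ)) j
  exact isCardinalAccessible_of_isColimit κ
    ((succStruct I κ₀).isColimitIterationCocone κ₀.ord.ToType)

/-- The functor sending an object to its morphism to the terminal object. -/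
noncomputable def toTerminalArrow (C : Type u) [Category.{v} C] [HasTerminal C] : C ⥤ Arrow C where
  obj X := Arrow.mk (terminal.from X)
  map f := Arrow.homMk f (𝟙 _)

/-- The target component is constant, and constant functors preserve κ-filtered colimits because
their shapes are connected. -/
instance [HasTerminal C] : (toTerminalArrow C).IsCardinalAccessible κ where
  preservesColimitOfShape J _ _ := ⟨⟨fun hc ↦
    have := Functor.preservesColimitsOfShape_of_isCardinalAccessible
      ((Functor.const C).obj (⊤_ C)) κ J
    ⟨Comma.fstSndJointlyReflectColimit hc
      (isColimitOfPreserves ((Functor.const C).obj (⊤_ C)) hc)⟩⟩⟩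

/-- The functorial factorization of the morphisms to the terminal object given by
the small object argument. -/
noncomputable def smallObjectReplacement [HasTerminal C] : C ⥤ C :=
  toTerminalArrow C ⋙ SmallObject.iteration I κ₀ ⋙ Arrow.leftFunc

lemma isCardinalAccessible_smallObjectReplacement [HasTerminal C]
    (hI : ∀ {A B : C} (i : A ⟶ B), I i → IsCardinalPresentable A κ ∧ IsCardinalPresentable B κ) :
    (smallObjectReplacement I κ₀).IsCardinalAccessible κ := by
  have := isCardinalAccessible_smallObject_iteration κ I κ₀ hI
  have : (Arrow.leftFunc : Arrow C ⥤ C).IsCardinalAccessible κ := { }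
  dsimp only [smallObjectReplacement]
  infer_instance

end

end BousfieldOhkawa



namespace BousfieldOhkawa

open CategoryTheory Limits Opposite

/-! ### Ohkawa's argument -/

section

variable {C : Type u} [Category.{v} C] (P : ObjectProperty C) (I : MorphismProperty C)

/-- The property that all morphisms from the source of a morphism in `I` to a given object
extend to the target. -/
def HasExtensions (Y : C) : Prop :=
  ∀ ⦃A B : C⦄ (i : A ⟶ B), I i → ∀ x : A ⟶ Y, ∃ d : B ⟶ Y, i ≫ d = x

/-- The set of the morphisms `g` from `X` to objects satisfying `P` such that
`x ≫ H.map g` extends along `i`. -/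
def extensionSet (H : C ⥤ C) (i : I.toSet) (X : Subtype P) (x : i.1.left ⟶ H.obj X.1) :
    Set (Σ Y : Subtype P, X.1 ⟶ Y.1) :=
  {g | ∃ d : i.1.right ⟶ H.obj g.1.1, i.1.hom ≫ d = x ≫ H.map g.2}

/-- The sets `extensionSet P I H i X x` for varying `x`. -/
def extensionSets (H : C ⥤ C) (i : I.toSet) (X : Subtype P) :
    Set (Set (Σ Y : Subtype P, X.1 ⟶ Y.1)) :=
  Set.range (extensionSet P I H i X)

variable {P I} {κ : Cardinal.{w}} [Fact κ.IsRegular]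
  (hP : P.IsCardinalFilteredGenerator κ)
  (hI : ∀ {A B : C} (i : A ⟶ B), I i → IsCardinalPresentable A κ ∧ IsCardinalPresentable B κ)

include hP hI

/-- No map between `H` and `H'` is available. A lifting problem for `H'`, brought down to a stage
`j`, is traded for one for `H` with the same extension set. Solving the latter over `X` shows that a
transition map `j ⟶ l` lies in that set. -/
lemma HasExtensions.of_extensionSets_eq {H H' : C ⥤ C} [H.IsCardinalAccessible κ]
    [H'.IsCardinalAccessible κ] (h : extensionSets P I H = extensionSets P I H') {X : C}
    (hX : HasExtensions I (H.obj X)) : HasExtensions I (H'.obj X) := by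
  intro A B i hi x'
  obtain ⟨_, _⟩ := hI i hi
  obtain ⟨J, _, _, ⟨p⟩⟩ := hP.exists_colimitsOfShape X
  have := isFiltered_of_isCardinalFiltered J κ
  have := H.preservesColimitsOfShape_of_isCardinalAccessible κ J
  have := H'.preservesColimitsOfShape_of_isCardinalAccessible κ J
  have hc := isColimitOfPreserves H p.isColimit
  have hc' := isColimitOfPreserves H' p.isColimit
  let o (j : J) : Subtype P := ⟨p.diag.obj j, p.prop_diag_obj j⟩
  let i₀ : I.toSet := ⟨Arrow.mk i, hi⟩
  obtain ⟨j, (x₁' : A ⟶ H'.obj (p.diag.obj j)), (hx₁' : x₁' ≫ H'.map (p.ι.app j) = x')⟩ :=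
    IsCardinalPresentable.exists_hom_of_isColimit κ hc' x'
  obtain ⟨(x₁ : A ⟶ H.obj (p.diag.obj j)), hx₁⟩ :
      extensionSet P I H' i₀ (o j) x₁' ∈ extensionSets P I H i₀ (o j) := by
    rw [h]
    exact ⟨_, rfl⟩
  obtain ⟨d, hd⟩ := hX i hi (x₁ ≫ H.map (p.ι.app j))
  obtain ⟨k, (d₁ : B ⟶ H.obj (p.diag.obj k)), (hd₁ : d₁ ≫ H.map (p.ι.app k) = d)⟩ :=
    IsCardinalPresentable.exists_hom_of_isColimit κ hc d
  obtain ⟨l, a, b, hab⟩ := IsCardinalPresentable.exists_eq_of_isColimit κ hc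
    (i₁ := k) (i₂ := j) (i ≫ d₁) x₁ (by
      change (i ≫ d₁) ≫ H.map (p.ι.app k) = x₁ ≫ H.map (p.ι.app j)
      rw [Category.assoc, hd₁, hd])
  replace hab : (i ≫ d₁) ≫ H.map (p.diag.map a) = x₁ ≫ H.map (p.diag.map b) := hab
  have mem : (⟨o l, p.diag.map b⟩ : Σ Y : Subtype P, (o j).1 ⟶ Y.1) ∈
      extensionSet P I H i₀ (o j) x₁ :=
    ⟨d₁ ≫ H.map (p.diag.map a), (Category.assoc _ _ _).symm.trans hab⟩
  rw [hx₁] at mem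
  obtain ⟨(d' : B ⟶ H'.obj (p.diag.obj l)),
    (hd' : i ≫ d' = x₁' ≫ H'.map (p.diag.map b))⟩ := mem
  refine ⟨d' ≫ H'.map (p.ι.app l), ?_⟩
  rw [← Category.assoc, hd', Category.assoc, ← H'.map_comp, ← hx₁']
  congr 2
  exact p.w b

/-- For a family of accessible functors `H` (with a uniform cardinal), there is only a set of
classes of objects `X` such that `H.obj X` has the extension property for a set of morphisms. -/
lemma small_range_hasExtensions [LocallySmall.{w} C] [ObjectProperty.Small.{w} P]
    [MorphismProperty.IsSmall.{w} I] {ι T : Type*} (H : ι → C ⥤ C)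
    [∀ e, (H e).IsCardinalAccessible κ] (q : T → C) :
    Small.{w} (Set.range (fun e ↦ {t | HasExtensions I ((H e).obj (q t))})) := by
  have : Small.{w} (Subtype P) := inferInstanceAs (ObjectProperty.Small.{w} P)
  -- The source is small because `P`, `I` and the hom-sets are. Each value goes to the class of a
  -- chosen index, which is the class of every index with that value.
  let s : Set.range (fun e ↦ extensionSets P I (H e)) →
      Set.range (fun e ↦ {t | HasExtensions I ((H e).obj (q t))}) :=
    fun y ↦ ⟨_, y.2.choose, rfl⟩
  refine small_of_surjective (f := s) ?_
  rintro ⟨_, e, rfl⟩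
  refine ⟨⟨_, e, rfl⟩, Subtype.ext ?_⟩
  have h := Exists.choose_spec (⟨e, rfl⟩ : extensionSets P I (H e) ∈
    Set.range (fun e ↦ extensionSets P I (H e)))
  ext t
  exact ⟨fun ht ↦ ht.of_extensionSets_eq hP hI h, fun ht ↦ ht.of_extensionSets_eq hP hI h.symm⟩

end

end BousfieldOhkawa



/-! ### Bousfield classes as extension properties -/

namespace BousfieldOhkawa

open CategoryTheory Limits Opposite MonoidalCategory HomotopicalAlgebra

lemma hasExtensions_iff_rlp {C : Type u} [Category.{v} C] (I : MorphismProperty C) {X T : C} (hT : IsTerminal T) (p : X ⟶ T) :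
    HasExtensions I X ↔ I.rlp p := by
  refine ⟨fun h A B i hi ↦ ⟨fun {x} {y} sq ↦ ?_⟩, fun h A B i hi x ↦ ?_⟩
  · obtain ⟨d, hd⟩ := h i hi x
    exact ⟨⟨{ l := d, fac_left := hd, fac_right := hT.hom_ext _ _ }⟩⟩
  · have := h i hi
    have sq : CommSq x i p (hT.from B) := ⟨hT.hom_ext _ _⟩
    exact ⟨sq.lift, sq.fac_left⟩

/-! ### Terminal objects in the homotopy category -/

section

variable {M : Type u} [Category.{v} M] [ModelCategory M]

lemma isIso_toHo_map {X Y : M} (f : X ⟶ Y) [WeakEquivalence f] : IsIso ((toHo M).map f) :=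
  Localization.inverts (toHo M) (weakEquivalences M) f (mem_weakEquivalences f)

lemma nonempty_isTerminal_toHo_obj_iff_of_weakEquivalence {X Y : M} (f : X ⟶ Y)
    [WeakEquivalence f] :
    Nonempty (IsTerminal ((toHo M).obj X)) ↔ Nonempty (IsTerminal ((toHo M).obj Y)) := by
  have := isIso_toHo_map f
  exact ⟨fun ⟨h⟩ ↦ ⟨h.ofIso (asIso ((toHo M).map f))⟩,
    fun ⟨h⟩ ↦ ⟨h.ofIso (asIso ((toHo M).map f)).symm⟩⟩

lemma weakEquivalence_terminal_from_iff {X Y : M} (f : X ⟶ Y) [WeakEquivalence f] :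
    WeakEquivalence (terminal.from X) ↔ WeakEquivalence (terminal.from Y) := by
  rw [← weakEquivalence_precomp_iff f (terminal.from Y), terminal.comp_from]

/-- The identity and the zero map of `X` agree in the homotopy category, hence are left homotopic,
so the zero map `t ≫ s` is a weak equivalence; `t` is a retract of it. -/
lemma weakEquivalence_terminal_from_of_isTerminal_toHo [HasZeroObject M] {X : M} [IsCofibrant X]
    [IsFibrant X] (hX : IsTerminal ((toHo M).obj X)) : WeakEquivalence (terminal.from X) := by
  have hT : IsZero (⊤_ M) := (isZero_zero M).of_iso
    (terminalIsTerminal.uniqueUpToIso (isZero_zero M).isTerminal)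
  let t : X ⟶ ⊤_ M := terminal.from X
  let s : ⊤_ M ⟶ X := hT.to_ X
  obtain ⟨P, ⟨h⟩⟩ : LeftHomotopyRel (𝟙 X) (t ≫ s) := by
    rw [LeftHomotopyRel.iff_map_eq (toHo M)]
    exact hX.hom_ext _ _
  have hts : WeakEquivalence (t ≫ s) :=
    (Cylinder.LeftHomotopy.weakEquivalence_iff P h).1 inferInstance
  rw [weakEquivalence_iff] at hts ⊢
  refine MorphismProperty.of_retract (f := t) (g := t ≫ s) ?_ hts
  exact
    { i := Arrow.homMk (𝟙 X) s
      r := Arrow.homMk (𝟙 X) t (by simp [t])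
      retract := by
        ext
        · simp
        · exact terminal.hom_ext _ _ }

/-- The terminal object is the empty product, which localization preserves since an empty product of
maps is an isomorphism. -/
lemma isTerminal_toHo_obj_terminal : Nonempty (IsTerminal ((toHo M).obj (⊤_ M))) := by
  have : (weakEquivalences M).IsStableUnderProductsOfShape PEmpty.{1} := by
    refine .mk _ _ (fun X₁ X₂ _ _ f _ ↦ ?_)
    have : IsIso (Limits.Pi.map f) := ⟨Limits.Pi.map (fun x : PEmpty.{1} ↦ x.elim), by ext ⟨⟩, by ext ⟨⟩⟩
    rw [← weakEquivalence_iff]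
    infer_instance
  have := Localization.preservesProductsOfShape (toHo M) (weakEquivalences M) PEmpty.{1}
  exact ⟨terminalIsTerminal.isTerminalObj (toHo M) _⟩

/-- In a pointed model category, an object is terminal in the homotopy category if and only if
its morphism to the terminal object is a weak equivalence. -/
lemma nonempty_isTerminal_toHo_obj_iff [HasZeroObject M] (X : M) :
    Nonempty (IsTerminal ((toHo M).obj X)) ↔ WeakEquivalence (terminal.from X) := by
  refine ⟨fun h ↦ ?_, fun h ↦ ?_⟩
  · let p := CofibrantObject.HoCat.pResolutionObj X
    let i := FibrantObject.HoCat.iResolutionObj (CofibrantObject.HoCat.resolutionObj X)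
    have := isCofibrant_of_cofibration i
    rw [← weakEquivalence_terminal_from_iff p, weakEquivalence_terminal_from_iff i]
    rw [← nonempty_isTerminal_toHo_obj_iff_of_weakEquivalence p,
      nonempty_isTerminal_toHo_obj_iff_of_weakEquivalence i] at h
    exact weakEquivalence_terminal_from_of_isTerminal_toHo h.some
  · rw [nonempty_isTerminal_toHo_obj_iff_of_weakEquivalence (terminal.from X)]
    exact isTerminal_toHo_obj_terminal

/-- By two-out-of-three, `X → *` is a weak equivalence exactly when the fibration in its
`J`-factorization is trivial, which is lifting against `I`. -/
lemma weakEquivalence_terminal_from_iff_hasExtensions {I J : MorphismProperty M}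
    (κ : Cardinal.{w}) [Fact κ.IsRegular] [OrderBot κ.ord.ToType]
    [J.IsCardinalForSmallObjectArgument κ]
    (hI : I.rlp = trivialFibrations M) (hJ : J.rlp = fibrations M) (X : M) :
    WeakEquivalence (terminal.from X) ↔
      HasExtensions I ((smallObjectReplacement J κ).obj X) := by
  let ι := SmallObject.ιObj J κ (terminal.from X)
  let π := SmallObject.πObj J κ (terminal.from X)
  have hι : trivialCofibrations M ι := by
    rw [← fibrations_llp, ← hJ]
    exact SmallObject.llp_rlp_ιObj J κ _
  have hπ : Fibration π := by
    rw [fibration_iff, ← hJ]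
    exact SmallObject.rlp_πObj J κ _
  have : WeakEquivalence ι := (weakEquivalence_iff _).2 hι.2
  rw [weakEquivalence_terminal_from_iff ι]
  refine Iff.trans ?_ (hasExtensions_iff_rlp I terminalIsTerminal π).symm
  rw [hI, Subsingleton.elim (terminal.from _) π]
  exact ⟨fun h ↦ mem_trivialFibrations π, fun h ↦ (weakEquivalence_iff _).2 h.2⟩

end

/-! ### The derived tensor product on cofibrant objects -/

section

variable {C₁ C₂ D H : Type*} [Category* C₁] [Category* C₂] [Category* D] [Category* H]
  {W₁ : MorphismProperty C₁} {W₂ : MorphismProperty C₂}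

/-- Transfers the universal property to opposites, so that results on right derived functors give
`isIso_of_isLeftDerivedFunctor`. -/
lemma isRightDerivedFunctor_op {F : C₂ ⥤ H} {L : C₂ ⥤ D} [L.IsLocalization W₂] {LF : D ⥤ H}
    (α : L ⋙ LF ⟶ F) [LF.IsLeftDerivedFunctor α W₂] :
    LF.op.IsRightDerivedFunctor (F := F.op) (L := L.op) (NatTrans.op α) W₂.op := by
  let unopTrans (G : Dᵒᵖ ⥤ Hᵒᵖ) (γ : F.op ⟶ L.op ⋙ G) : L ⋙ G.unop ⟶ F :=
    { app X := (γ.app (op X)).unop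
      naturality X Y f := Quiver.Hom.op_inj (γ.naturality f.op).symm }
  let desc (G : Dᵒᵖ ⥤ Hᵒᵖ) (γ : F.op ⟶ L.op ⋙ G) : LF.op ⟶ G :=
    { app X := ((LF.leftDerivedLift α W₂ G.unop (unopTrans G γ)).app X.unop).op
      naturality X Y f := Quiver.Hom.unop_inj
        ((LF.leftDerivedLift α W₂ G.unop (unopTrans G γ)).naturality f.unop).symm }
  have fac (G : Dᵒᵖ ⥤ Hᵒᵖ) (γ : F.op ⟶ L.op ⋙ G) :
      NatTrans.op α ≫ Functor.whiskerLeft L.op (desc G γ) = γ := by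
    ext X
    exact Quiver.Hom.unop_inj (LF.leftDerived_fac_app α W₂ G.unop (unopTrans G γ) X.unop)
  have ext' (G : Dᵒᵖ ⥤ Hᵒᵖ) (γ γ' : LF.op ⟶ G)
      (h : NatTrans.op α ≫ Functor.whiskerLeft L.op γ =
        NatTrans.op α ≫ Functor.whiskerLeft L.op γ') : γ = γ' := by
    let t (δ : LF.op ⟶ G) : G.unop ⟶ LF :=
      { app X := (δ.app (op X)).unop
        naturality X Y f := Quiver.Hom.op_inj (δ.naturality f.op).symm }
    have key : t γ = t γ' := LF.leftDerived_ext α W₂ G.unop _ _ (by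
      ext X
      exact Quiver.Hom.op_inj (congr_app h (op X)))
    ext X
    exact congrArg Quiver.Hom.op (congr_app key X.unop)
  exact ⟨⟨⟨IsInitial.ofUniqueHom
    (fun G ↦ StructuredArrow.homMk (desc G.right G.hom) (fac G.right G.hom))
    (fun G m ↦ StructuredArrow.hom_ext _ _
      (ext' G.right _ _ ((StructuredArrow.w m).trans (fac G.right G.hom).symm)))⟩⟩⟩

lemma isIso_of_isLeftDerivedFunctor {Φ : LocalizerMorphism W₁ W₂} {F : C₂ ⥤ H}
    (h : Φ.Derives F) [Φ.IsLeftDerivabilityStructure] {L : C₂ ⥤ D} [L.IsLocalization W₂]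
    {LF : D ⥤ H} (α : L ⋙ LF ⟶ F) [LF.IsLeftDerivedFunctor α W₂] (X : C₁) :
    IsIso (α.app (Φ.functor.obj X)) := by
  have h' : Φ.op.Derives F.op := fun _ _ f hf ↦ by
    have := h f.unop hf
    exact inferInstanceAs (IsIso ((Φ.functor ⋙ F).map f.unop).op)
  have := isRightDerivedFunctor_op (W₂ := W₂) α
  have : IsIso (α.app (Φ.functor.obj X)).op :=
    h'.isIso_of_isRightDerivedFunctor (L₂ := L.op) (RF := LF.op) (NatTrans.op α) (op X)
  exact (isIso_op_iff _).1 this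

end

section

variable {M : Type u} [Category.{v} M] [ModelCategory M] [MonoidalCategory M]
  [IsMonoidalModelCategory M]

/-- On cofibrant objects, the derived tensor product is the tensor product. -/
lemma nonempty_derivedTensor_obj_iso (E X : M) [IsCofibrant E] [IsCofibrant X] :
    Nonempty ((derivedTensor M).obj ((toHo M).obj E, (toHo M).obj X) ≅ (toHo M).obj (E ⊗ X)) := by
  let α := (tensor M ⋙ toHo M).totalLeftDerivedCounit ((toHo M).prod (toHo M))
    ((weakEquivalences M).prod (weakEquivalences M))
  have : IsIso (α.app (E, X)) := isIso_of_isLeftDerivedFunctor (derives_tensor (M := M)) α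
    (CofibrantObject.mk E, CofibrantObject.mk X)
  let e := asIso (α.app (E, X))
  exact ⟨e⟩

lemma mem_bousfieldClass_iff (E X : M) :
    X ∈ bousfieldClass E ↔
      Nonempty (IsTerminal ((toHo M).obj
        (CofibrantObject.HoCat.resolutionObj E ⊗ CofibrantObject.HoCat.resolutionObj X))) := by
  have h₁ := isIso_toHo_map (CofibrantObject.HoCat.pResolutionObj E)
  have h₂ := isIso_toHo_map (CofibrantObject.HoCat.pResolutionObj X)
  obtain ⟨e⟩ := nonempty_derivedTensor_obj_iso (CofibrantObject.HoCat.resolutionObj E)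
    (CofibrantObject.HoCat.resolutionObj X)
  let e' := (derivedTensor M).mapIso (Iso.prod (asIso ((toHo M).map
    (CofibrantObject.HoCat.pResolutionObj E))) (asIso ((toHo M).map
    (CofibrantObject.HoCat.pResolutionObj X))))
  exact ⟨fun ⟨h⟩ ↦ ⟨h.ofIso (e'.symm ≪≫ e)⟩, fun ⟨h⟩ ↦ ⟨h.ofIso (e.symm ≪≫ e')⟩⟩

end

/-! ### The cardinality bound -/

/-- In a locally presentable category, the sources and targets of a small class of morphisms
are `κ`-presentable for some regular cardinal `κ` such that the category is locally
`κ`-presentable. -/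
lemma exists_isCardinalLocallyPresentable (C : Type u) [Category.{v} C]
    [IsLocallyPresentable.{w} C] (I : MorphismProperty C) [MorphismProperty.IsSmall.{w} I] :
    ∃ (κ : Cardinal.{w}) (_ : Fact κ.IsRegular), IsCardinalLocallyPresentable C κ ∧
      ∀ {A B : C} (i : A ⟶ B), I i → IsCardinalPresentable A κ ∧ IsCardinalPresentable B κ := by
  obtain ⟨κ₀, _, _⟩ := IsLocallyPresentable.exists_cardinal.{w} C
  choose κ hκ hX using fun X : C ↦ (inferInstance : IsPresentable.{w} X).exists_cardinal
  -- The small index type collects `κ₀` and the presentability ranks of all sources and targets; `μ`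
  -- bounds them all.
  obtain ⟨μ, hμ, h⟩ := HasCardinalLT.exists_regular_cardinal_forall.{w}
    (fun x : Unit ⊕ I.toSet ⊕ I.toSet ↦ (Sum.elim (fun _ ↦ κ₀)
      (Sum.elim (fun i ↦ κ i.1.left) (fun i ↦ κ i.1.right)) x).ord.ToType)
  have : Fact μ.IsRegular := ⟨hμ⟩
  have le (x : Unit ⊕ I.toSet ⊕ I.toSet) : Sum.elim (fun _ ↦ κ₀)
      (Sum.elim (fun i ↦ κ i.1.left) (fun i ↦ κ i.1.right)) x ≤ μ :=
    le_of_lt (by simpa [hasCardinalLT_iff_cardinal_mk_lt] using h x)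
  have h₀ : κ₀ ≤ μ := le (.inl ())
  refine ⟨μ, inferInstance, IsCardinalLocallyPresentable.of_le C h₀, fun {A B} i hi ↦ ?_⟩
  have hA : κ A ≤ μ := le (.inr (.inl ⟨Arrow.mk i, hi⟩))
  have hB : κ B ≤ μ := le (.inr (.inr ⟨Arrow.mk i, hi⟩))
  have := hX A
  have := hX B
  exact ⟨isCardinalPresentable_of_le A hA, isCardinalPresentable_of_le B hB⟩

end BousfieldOhkawa

open CategoryTheory Limits HomotopicalAlgebra BousfieldOhkawa in
theorem corollary3p3 {M : Type u} [Category.{v} M] [ModelCategory M] [IsCombinatorial.{w} M]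
    [HasZeroObject M] [MonoidalCategory M] [IsMonoidalModelCategory M] :
    Small.{w} (Set.range (bousfieldClass : M → Set M)) := by
  have := IsCombinatorial.isLocallyPresentable (M := M)
  have := IsCombinatorial.isCofibrantlyGenerated (M := M)
  obtain ⟨I, J, _, _, _, hJ, hI', hJ'⟩ := IsCofibrantlyGenerated.exists_generators.{w} (M := M)
  obtain ⟨κ₀, _, _, _⟩ := hJ.exists_cardinal
  -- One `κ` must serve `J`, for accessibility of the replacement, and `I`, for testing extensions.
  have : MorphismProperty.IsSmall.{w} (I ⊔ J) := by
    have (b : Bool) : MorphismProperty.IsSmall.{w} (cond b I J) := by cases b <;> assumption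
    rw [sup_eq_iSup]
    infer_instance
  obtain ⟨κ, _, _, hκ⟩ := exists_isCardinalLocallyPresentable.{w} M (I ⊔ J)
  obtain ⟨P, _, hP⟩ := HasCardinalFilteredGenerator.exists_small_generator M κ
  have hR := isCardinalAccessible_smallObjectReplacement κ J κ₀
    (fun i hi ↦ hκ i (le_sup_right (a := I) _ hi))
  let H (E : M) : M ⥤ M :=
    MonoidalCategory.tensorLeft (CofibrantObject.HoCat.resolutionObj E) ⋙
      smallObjectReplacement J κ₀
  have (E : M) : (H E).IsCardinalAccessible κ := by
    have := IsMonoidalModelCategory.isLeftAdjoint_tensorLeft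
      (CofibrantObject.HoCat.resolutionObj E)
    have : (MonoidalCategory.tensorLeft
      (CofibrantObject.HoCat.resolutionObj E)).IsCardinalAccessible κ := { }
    dsimp only [H]
    infer_instance
  -- Cofibrant replacement of `X` enters only as a function on objects, so its accessibility plays
  -- no role.
  have key := small_range_hasExtensions hP (fun i hi ↦ hκ i (le_sup_left (b := J) _ hi)) H
    (fun X : M ↦ CofibrantObject.HoCat.resolutionObj X)
  convert key using 4 with E
  ext X
  rw [mem_bousfieldClass_iff, nonempty_isTerminal_toHo_obj_iff,
    weakEquivalence_terminal_from_iff_hasExtensions κ₀ hI' hJ']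
  rfl
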